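/- **Network.** Consider the directed acyclic network with source node $s$, sink node $d$, intermediate nodes $a,b,c,t_1,t_3,h_1,h_2,h_4,e,f,g$, and the following 21 links, each a noise-free link of capacity one bit per time unit: - first layer: $s\to a$, $s\to b$, $s\to c$; - connecting links: $a\to t_1$, $c\to t_1$, $a\to t_3$, $b\to t_3$; - middle layer: link 1: $t_1\to h_1$; link 2: $a\to h_2$; link 3: $t_3\to e$; link 4: $b\to h_4$; link 5: $c\to g$; - connecting links: $h_1\to e$, $h_1\to g$, $h_2\to e$, $h_2\to f$, $h_4\to f$, $h_4\to g$; - last layer: link 6: $e\to d$; link 7: $f\to d$; link 8: $g\to d$. A wiretapper observes a set $A$ of links; the collection $\mathcal W$ of permissible wiretap sets consists of all sets of exactly three of the five middle-layer links 1-5. **Codes.** A block code of blocklength $n$ for a source block $X^n\in\mathcal X^n$ ($\mathcal X$ a finite alphabet) sends on each link one of $2^n$ symbols. The symbol on a link is an arbitrary (linear or nonlinear) function of the symbols received by the tail node of the link, of the source block if the tail is $s$, and of a local random key of the tail node. The keys of different nodes (including $s$) are independent of each other and of $X^n$, and may have any distribution. The sink reconstructs the source block as a function of the symbols on links 6, 7,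 8. A secrecy rate $R$ is achievable with unknown wiretap set if there are a source, i.e. a finite alphabet $\mathcal X$ and laws of the blocks $X^n$, with $\liminf_n H(X^n)/n\ge R$ (entropy in bits), and a sequence of block codes, one for each $n$, whose error probability at the sink tends to $0$ as $n\to\infty$ and for which, for every $n$ and every $A\in\mathcal W$, the mutual information between $X^n$ and the symbols on the links in $A$ is zero. It is achievable with known wiretap set if the codes may depend on $A$: there is such a source for which, for every $A\in\mathcal W$, there is a sequence of block codes with error probability tending to $0$ and with zero mutual information between $X^n$ and the symbols on the links in $A$. **Theorem 2.** For this network: 1. the cut-set bound $\displaystyle\min_{S\ni s,\ S\not\ni d}\ \min_{A\in\mathcal W}\ \bigl|\{(u,v)\ \text{a link}: u\in S,\ v\notin S,\ (u,v)\notin A\}\bigr|$ equals $2$; 2. the secrecy rate $2$ is achievable when the wiretap set is known to the communicating nodes; 3. the secrecy rate $2$ is not achievable, by any linear or nonlinear coding scheme, when the wiretap set is unknown to the communicating nodes. -/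

import Mathlib

open MeasureTheory Filter Topology
open scoped ENNReal

universe u

namespace SecureNet

/-! ### Unit-capacity wireline networks and the cut-set bound -/

/-- A directed acyclic network with node set `V`, link set `E` (parallel links are allowed), one
source and one sink. Every link is a noise-free bit-pipe of capacity one bit per time unit.
Acyclicity is recorded by a topological numbering `rank` of the nodes. -/
structure Network (V E : Type) where
  tail : E → V
  head : E → V
  source : V
  sink : V
  rank : V → ℕ
  rank_lt : ∀ e, rank (tail e) < rank (head e)

section general

variable {V E : Type}

/-- The cut-set bound for the collection `W` of permissible wiretap sets: the minimum, over all
source-sink cuts `S` and all wiretap sets `A ∈ W`, of the total capacity of the links that go from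
`S` to its complement and do not belong to `A`. All links have capacity one, so that this total
capacity is a number of links. -/
noncomputable def Network.cutSetBound (N : Network V E) (W : Set (Finset E)) : ℕ∞ :=
  ⨅ (S : Set V) (_ : N.source ∈ S ∧ N.sink ∉ S) (A : Finset E) (_ : A ∈ W),
    Set.encard {e : E | N.tail e ∈ S ∧ N.head e ∉ S ∧ e ∉ A}

/-! ### Sources, codes and secrecy -/

/-- A source with the finite alphabet `Fin q`: for every blocklength `n` the law of the source block
(the secret message). A uniformly distributed message and an i.i.d. source are special cases. -/
structure Source where
  q : ℕ
  law : (n : ℕ) → PMF (Fin n → Fin q)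

/-- Shannon entropy, in bits, of a law on a finite set. -/
noncomputable def entropyBits {α : Type} [Fintype α] (p : PMF α) : ℝ :=
  (∑ a, Real.negMulLog (p a).toReal) / Real.log 2

/-- The source produces, asymptotically, at least `R` bits per time unit:
`liminf H(Xⁿ) / n ≥ R`. -/
def Source.HasRate (X : Source) (R : ℝ) : Prop :=
  ∀ δ : ℝ, 0 < δ → ∀ᶠ n : ℕ in atTop, R - δ ≤ entropyBits (X.law n) / n

/-- A block code of blocklength `n` for source blocks in `(Fin q) ^ n`. In `n` time units a link
carries one of `2 ^ n` symbols. Every node `v` (the source node included) may use a local random key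
with values in an arbitrary measurable space `Key v`; the keys of different nodes are independent of
each other and of the source block. The symbol on a link `e` is an arbitrary function of the source
block, if `e` leaves the source node, of the symbols on all the links that enter the tail of `e`,
and of the local key of the tail of `e`. -/
structure Code (N : Network V E) (q n : ℕ) where
  Key : V → Type u
  [keySpace : ∀ v, MeasurableSpace (Key v)]
  keyLaw : (v : V) → Measure (Key v)
  [keyProb : ∀ v, IsProbabilityMeasure (keyLaw v)]
  enc : (e : E) → (N.tail e = N.source → Fin n → Fin q) →
    ({d : E // N.head d = N.tail e} → Fin (2 ^ n)) → Key (N.tail e) → Fin (2 ^ n)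
  enc_measurable : ∀ e src inc, Measurable (enc e src inc)
  dec : ({d : E // N.head d = N.sink} → Fin (2 ^ n)) → Fin n → Fin q

attribute [instance] Code.keySpace Code.keyProb

namespace Code

variable {N : Network V E} {q n : ℕ}

/-- The outcomes: a source block, and a local key for every node. -/
abbrev Outcome (C : Code.{u} N q n) : Type u :=
  (Fin n → Fin q) × ((v : V) → C.Key v)

/-- The joint law of the source block and the local keys, which are all independent. -/
noncomputable def outcomeLaw [Fintype V] (C : Code.{u} N q n) (p : PMF (Fin n → Fin q)) :
    Measure C.Outcome :=
  p.toMeasure.prod (Measure.pi C.keyLaw)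

/-- The symbol carried by the link `e`; the node mappings are applied in topological order. -/
def signal (C : Code.{u} N q n) (e : E) (ω : C.Outcome) : Fin (2 ^ n) :=
  C.enc e (fun _ => ω.1) (fun d => C.signal d.1 ω) (ω.2 (N.tail e))
termination_by N.rank (N.tail e)
decreasing_by
  have h := N.rank_lt d.1
  rw [d.2] at h
  exact h

/-- The source block as reconstructed at the sink. -/
def decoded (C : Code.{u} N q n) (ω : C.Outcome) : Fin n → Fin q :=
  C.dec fun d => C.signal d.1 ω

/-- The probability of decoding error. -/
noncomputable def errorProb [Fintype V] (C : Code.{u} N q n) (p : PMF (Fin n → Fin q)) : ℝ≥0∞ :=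
  C.outcomeLaw p {ω | C.decoded ω ≠ ω.1}

/-- What a wiretapper of the links in `A` sees. -/
def observed (C : Code.{u} N q n) (A : Finset E) (ω : C.Outcome) : {e : E // e ∈ A} → Fin (2 ^ n) :=
  fun e => C.signal e.1 ω

end Code

/-- Mutual information (in nats) of two random variables: the Kullback-Leibler divergence of their
joint law from the product of their laws. -/
noncomputable def mutualInfo {Ω : Type u} {α β : Type} [MeasurableSpace Ω] [MeasurableSpace α]
    [MeasurableSpace β] (μ : Measure Ω) (X : Ω → α) (Y : Ω → β) : ℝ≥0∞ :=
  InformationTheory.klDiv (μ.map fun ω => (X ω, Y ω)) ((μ.map X).prod (μ.map Y))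

/-- The code reveals no information about the source block to a wiretapper who sees the links of any
one of the sets in `W`. -/
def Code.IsSecret [Fintype V] {N : Network V E} {q n : ℕ} (C : Code.{u} N q n)
    (p : PMF (Fin n → Fin q)) (W : Set (Finset E)) : Prop :=
  ∀ A ∈ W, mutualInfo (C.outcomeLaw p) (fun ω => ω.1) (C.observed A) = 0

/-- The source can be communicated over `N` in perfect secrecy from a wiretapper who sees the links
of an unknown set in `W`: there is a sequence of block codes with zero mutual information between
the source block and the observations on each set in `W`, and with error probability tending
to zero. The codes do not depend on the choice of the wiretap set in `W`. -/
def Network.CommunicatesSecretly [Fintype V] (N : Network V E) (W : Set (Finset E)) (X : Source) :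
    Prop :=
  ∃ C : (n : ℕ) → Code.{u} N X.q n,
    (∀ n, (C n).IsSecret (X.law n) W) ∧
    Tendsto (fun n => (C n).errorProb (X.law n)) atTop (𝓝 0)

/-- The secrecy rate `R` is achievable when the choice of the wiretap set in `W` is unknown to the
communicating nodes. -/
def Network.Achievable [Fintype V] (N : Network V E) (W : Set (Finset E)) (R : ℝ) : Prop :=
  ∃ X : Source, X.HasRate R ∧ CommunicatesSecretly.{u} N W X

/-- The secrecy rate `R` is achievable when the choice of the wiretap set in `W` is known to the
communicating nodes: the codes may depend on it. -/
def Network.AchievableKnown [Fintype V] (N : Network V E) (W : Set (Finset E)) (R : ℝ) : Prop :=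
  ∃ X : Source, X.HasRate R ∧ ∀ A ∈ W, CommunicatesSecretly.{u} N {A} X

end general

/-! ### The network with five wiretappable links -/

/-- The nodes: the source `s`, the sink `d`, the heads `a`, `b`, `c` of the first-layer links, the
tails `t1`, `t3` of the middle-layer links 1 and 3 (links 2, 4, 5 leave `a`, `b`, `c`), the heads
`h1`, `h2`, `h4` of the middle-layer links 1, 2, 4 (links 3 and 5 enter `e` and `g`), and the tails
`e`, `f`, `g` of the last-layer links. -/
inductive Node
  | s | a | b | c | t1 | t3 | h1 | h2 | h4 | e | f | g | d
  deriving DecidableEq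

instance : Fintype Node where
  elems := {.s, .a, .b, .c, .t1, .t3, .h1, .h2, .h4, .e, .f, .g, .d}
  complete := by intro v; cases v <;> decide

/-- The links. `z1`, `z2`, `z3` form the first layer, `l1`, ..., `l5` the middle layer, and `l6`,
`l7`, `l8` the last layer; the name of any other link lists its two ends. -/
inductive Link
  | z1 | z2 | z3
  | a_t1 | c_t1 | a_t3 | b_t3
  | l1 | l2 | l3 | l4 | l5
  | h1_e | h1_g | h2_e | h2_f | h4_f | h4_g
  | l6 | l7 | l8
  deriving DecidableEq

/-- The tail and the head of each link. -/
def Link.ends : Link → Node × Node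
  | z1 => (.s, .a)
  | z2 => (.s, .b)
  | z3 => (.s, .c)
  | a_t1 => (.a, .t1)
  | c_t1 => (.c, .t1)
  | a_t3 => (.a, .t3)
  | b_t3 => (.b, .t3)
  | l1 => (.t1, .h1)
  | l2 => (.a, .h2)
  | l3 => (.t3, .e)
  | l4 => (.b, .h4)
  | l5 => (.c, .g)
  | h1_e => (.h1, .e)
  | h1_g => (.h1, .g)
  | h2_e => (.h2, .e)
  | h2_f => (.h2, .f)
  | h4_f => (.h4, .f)
  | h4_g => (.h4, .g)
  | l6 => (.e, .d)
  | l7 => (.f, .d)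
  | l8 => (.g, .d)

/-- A topological numbering of the nodes. -/
def Node.rank : Node → ℕ
  | s => 0
  | a | b | c => 1
  | t1 | t3 => 2
  | h1 | h2 | h4 => 3
  | e | f | g => 4
  | d => 5

/-- The network: links 1-5 of the middle layer are fed by `{a, c}`, `a`, `{a, b}`, `b`, `c`
respectively, and links 6, 7, 8 of the last layer by links `{1, 2, 3}`, `{2, 4}`, `{1, 4, 5}`. -/
def fiveLinkNetwork : Network Node Link where
  tail l := l.ends.1
  head l := l.ends.2
  source := .s
  sink := .d
  rank := Node.rank
  rank_lt := by intro l; cases l <;> decide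

/-- The five links of the middle layer. -/
def middleLayer : Finset Link := {.l1, .l2, .l3, .l4, .l5}

/-- The permissible wiretap sets: any three of the five middle-layer links. -/
def wiretapSets : Set (Finset Link) := {A | A ⊆ middleLayer ∧ A.card = 3}

end SecureNet

/-! Write M for the source block, Z for the first layer, Li for the symbol on link i, and suppose
first that rate 2 is reached with exact decoding. Links 1, 2, 5 reveal nothing about M, so M must
account for the full two bits of links 3 and 4: given M, L1, L2, L5, nothing random is left in L4.
Link 4 leaves `b`, and links 1, 2, 5 do not depend on the key of `b`; hence L4 is independent of
them given M and Z, and H(L4 | M, Z) ≤ H(L4 | M, L1, L2, L5) = 0. The same argument with `c` and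
links 2, 3, 4 gives H(L5 | M, Z) = 0. But L4, L5 carry two bits, because links 1, 2, 3 reveal
nothing, and they are independent of M, because links 2, 4, 5 reveal nothing. So M, L4, L5 hold four
bits and are determined by Z, which has only three.

With h = n log 2 and ε = H(M | reconstruction), the same steps give 4 H(M) ≤ 7h + 4ε
(`four_mul_ent_message_le`), and Fano's inequality makes ε negligible against n. The Markov
relations rest on `Code.ent_add_of_fresh_keys`, the independence of local keys.

For the positive claims, every wiretap set is avoided by two link-disjoint paths
(`exists_disjoint_paths`). They force two unobserved links across each cut, and they carry the two
halves of a uniform block while all other links stay constant. -/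

namespace SecureNet

/-! ### Shannon entropy of finitely valued random variables -/

section entropy

set_option linter.unusedSectionVars false

variable {Ω : Type u} [MeasurableSpace Ω] {α β γ : Type} [Fintype α] [Fintype β] [Fintype γ]
  [MeasurableSpace α] [MeasurableSpace β] [MeasurableSpace γ]
  [MeasurableSingletonClass α] [MeasurableSingletonClass β] [MeasurableSingletonClass γ]
  {μ : Measure Ω} {X : Ω → α} {Y : Ω → β} {Z : Ω → γ}

/-- The probability that `X` takes the value `x`. -/
noncomputable def mass (μ : Measure Ω) (X : Ω → α) (x : α) : ℝ := μ.real (X ⁻¹' {x})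

/-- The entropy, in nats, of a finitely valued random variable. -/
noncomputable def ent (μ : Measure Ω) (X : Ω → α) : ℝ := ∑ x, Real.negMulLog (mass μ X x)

theorem mass_nonneg (x : α) : 0 ≤ mass μ X x := measureReal_nonneg

theorem mass_comp [IsProbabilityMeasure μ] [DecidableEq β] (hX : Measurable X) (f : α → β) (y : β) :
    mass μ (fun ω => f (X ω)) y = ∑ x with f x = y, mass μ X x := by
  unfold mass
  rw [sum_measureReal_preimage_singleton _ fun x _ => hX (measurableSet_singleton x)]
  congr 1
  ext ω
  simp

theorem sum_mass [IsProbabilityMeasure μ] (hX : Measurable X) : ∑ x, mass μ X x = 1 := by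
  unfold mass
  rw [sum_measureReal_preimage_singleton _ fun x _ => hX (measurableSet_singleton x)]
  simp

theorem mass_le_mass_comp [IsProbabilityMeasure μ] (f : α → β) (x : α) :
    mass μ X x ≤ mass μ (fun ω => f (X ω)) (f x) := by
  refine measureReal_mono fun ω hω => ?_
  simp only [Set.mem_preimage, Set.mem_singleton_iff] at hω ⊢
  rw [hω]

/-- The entropy of a function of `X`, as an expectation over the values of `X`. -/
theorem ent_comp [IsProbabilityMeasure μ] (hX : Measurable X) (f : α → β) :
    ent μ (fun ω => f (X ω)) =
      ∑ x, mass μ X x * -Real.log (mass μ (fun ω => f (X ω)) (f x)) := by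
  classical
  unfold ent
  rw [← Finset.sum_fiberwise (s := Finset.univ) (g := f)]
  refine Finset.sum_congr rfl fun y _ => ?_
  rw [Real.negMulLog, neg_mul, ← mul_neg]
  nth_rewrite 1 [mass_comp hX f y]
  rw [Finset.sum_mul]
  refine Finset.sum_congr rfl fun x hx => ?_
  rw [(Finset.mem_filter.1 hx).2]

theorem ent_eq_sum [IsProbabilityMeasure μ] (hX : Measurable X) :
    ent μ X = ∑ x, mass μ X x * -Real.log (mass μ X x) := ent_comp hX id

theorem ent_comp_le [IsProbabilityMeasure μ] (hX : Measurable X) (f : α → β) :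
    ent μ (fun ω => f (X ω)) ≤ ent μ X := by
  rw [ent_comp hX f, ent_eq_sum hX]
  refine Finset.sum_le_sum fun x _ => ?_
  rcases (mass_nonneg (μ := μ) (X := X) x).eq_or_lt with h | h
  · simp [← h]
  · exact mul_le_mul_of_nonneg_left (neg_le_neg (Real.log_le_log h (mass_le_mass_comp f x))) h.le

/-- A random variable has at most the entropy of any random variable that determines it. -/
theorem ent_le_of_determines [IsProbabilityMeasure μ] (hX : Measurable X)
    (h : ∀ ω ω', X ω = X ω' → Y ω = Y ω') : ent μ Y ≤ ent μ X := by
  classical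
  obtain ⟨ω₀⟩ : Nonempty Ω := nonempty_of_isProbabilityMeasure μ
  let f : α → β := fun x => if hx : ∃ ω, X ω = x then Y hx.choose else Y ω₀
  have : Y = fun ω => f (X ω) := by
    funext ω
    have hx : ∃ ω', X ω' = X ω := ⟨ω, rfl⟩
    simp only [f, hx, dif_pos]
    exact (h _ _ hx.choose_spec).symm
  rw [this]
  exact ent_comp_le hX f

/-- This is log t ≤ t - 1 at t = r / p. Applied termwise with comparison weights `r` of total at
most one, it yields submodularity, the cardinality bound and Fano's inequality. -/
theorem mul_log_div_le {p r : ℝ} (hp : 0 < p) (hr : 0 < r) :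
    p * (Real.log r - Real.log p) ≤ r - p := by
  have h := mul_le_mul_of_nonneg_left (Real.log_le_sub_one_of_pos (div_pos hr hp)) hp.le
  rw [Real.log_div hr.ne' hp.ne'] at h
  refine h.trans_eq ?_
  field_simp

theorem sum_mass_prod_left [IsProbabilityMeasure μ] (hX : Measurable X) (hY : Measurable Y)
    (y : β) : ∑ x, mass μ (fun ω => (X ω, Y ω)) (x, y) = mass μ Y y := by
  classical
  have h := mass_comp (μ := μ) (hX.prodMk hY) Prod.snd y
  simp only at h
  rw [h]
  refine Finset.sum_bij' (fun x _ => (x, y)) (fun p _ => p.1) ?_ ?_ ?_ ?_ ?_ <;> simp +contextual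

/-- Submodularity of the entropy. -/
theorem ent_submodular [IsProbabilityMeasure μ] (hX : Measurable X) (hY : Measurable Y)
    (hZ : Measurable Z) :
    ent μ (fun ω => (X ω, Y ω, Z ω)) + ent μ Z ≤
      ent μ (fun ω => (X ω, Z ω)) + ent μ (fun ω => (Y ω, Z ω)) := by
  have hW : Measurable fun ω => (X ω, Y ω, Z ω) := hX.prodMk (hY.prodMk hZ)
  set W : Ω → α × β × γ := fun ω => (X ω, Y ω, Z ω) with hWdef
  have e1 := ent_eq_sum (μ := μ) hW
  have e2 : ent μ Z = _ := ent_comp (μ := μ) hW fun w => w.2.2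
  have e3 : ent μ (fun ω => (X ω, Z ω)) = _ := ent_comp (μ := μ) hW fun w => (w.1, w.2.2)
  have e4 : ent μ (fun ω => (Y ω, Z ω)) = _ := ent_comp (μ := μ) hW fun w => (w.2.1, w.2.2)
  have m2 : ∀ w, mass μ W w ≤ mass μ Z w.2.2 :=
    mass_le_mass_comp (X := W) fun w : α × β × γ => w.2.2
  have m3 : ∀ w, mass μ W w ≤ mass μ (fun ω => (X ω, Z ω)) (w.1, w.2.2) :=
    mass_le_mass_comp (X := W) fun w : α × β × γ => (w.1, w.2.2)
  have m4 : ∀ w, mass μ W w ≤ mass μ (fun ω => (Y ω, Z ω)) (w.2.1, w.2.2) :=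
    mass_le_mass_comp (X := W) fun w : α × β × γ => (w.2.1, w.2.2)
  simp only [hWdef] at e2 e3 e4
  have key : ∀ w, mass μ W w * -Real.log (mass μ W w) + mass μ W w * -Real.log (mass μ Z w.2.2)
      - mass μ W w * -Real.log (mass μ (fun ω => (X ω, Z ω)) (w.1, w.2.2))
      - mass μ W w * -Real.log (mass μ (fun ω => (Y ω, Z ω)) (w.2.1, w.2.2)) ≤
      mass μ (fun ω => (X ω, Z ω)) (w.1, w.2.2) * mass μ (fun ω => (Y ω, Z ω)) (w.2.1, w.2.2)
        / mass μ Z w.2.2 - mass μ W w := by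
    intro w
    rcases (mass_nonneg (μ := μ) (X := W) w).eq_or_lt with h | h
    · rw [← h]
      simp only [zero_mul, sub_zero, add_zero]
      exact div_nonneg (mul_nonneg (mass_nonneg _) (mass_nonneg _)) (mass_nonneg _)
    · have h2 := h.trans_le (m2 w)
      have h3 := h.trans_le (m3 w)
      have h4 := h.trans_le (m4 w)
      have := mul_log_div_le h (div_pos (mul_pos h3 h4) h2)
      rw [Real.log_div (mul_pos h3 h4).ne' h2.ne', Real.log_mul h3.ne' h4.ne'] at this
      linarith
  have tot : ∑ w : α × β × γ, mass μ (fun ω => (X ω, Z ω)) (w.1, w.2.2) *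
      mass μ (fun ω => (Y ω, Z ω)) (w.2.1, w.2.2) / mass μ Z w.2.2 ≤ 1 := by
    rw [← sum_mass (μ := μ) hZ, Fintype.sum_prod_type]
    simp_rw [Fintype.sum_prod_type]
    rw [Finset.sum_congr rfl fun x _ => Finset.sum_comm, Finset.sum_comm]
    refine Finset.sum_le_sum fun z _ => ?_
    simp_rw [← Finset.sum_div, ← Finset.mul_sum, ← Finset.sum_mul]
    rw [sum_mass_prod_left hX hZ, sum_mass_prod_left hY hZ]
    exact (mul_self_div_self _).le
  have := Finset.sum_le_sum fun w (_ : w ∈ Finset.univ) => key w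
  simp only [Finset.sum_sub_distrib, Finset.sum_add_distrib, sum_mass hW] at this
  rw [e1, e2, e3, e4]
  linarith

/-- Equality in submodularity for conditionally independent random variables. -/
theorem ent_add_of_condIndep [IsProbabilityMeasure μ] (hX : Measurable X) (hY : Measurable Y)
    (hZ : Measurable Z)
    (h : ∀ x y z, mass μ (fun ω => (X ω, Y ω, Z ω)) (x, y, z) * mass μ Z z =
      mass μ (fun ω => (X ω, Z ω)) (x, z) * mass μ (fun ω => (Y ω, Z ω)) (y, z)) :
    ent μ (fun ω => (X ω, Y ω, Z ω)) + ent μ Z =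
      ent μ (fun ω => (X ω, Z ω)) + ent μ (fun ω => (Y ω, Z ω)) := by
  have hW : Measurable fun ω => (X ω, Y ω, Z ω) := hX.prodMk (hY.prodMk hZ)
  set W : Ω → α × β × γ := fun ω => (X ω, Y ω, Z ω) with hWdef
  have e1 := ent_eq_sum (μ := μ) hW
  have e2 : ent μ Z = _ := ent_comp (μ := μ) hW fun w => w.2.2
  have e3 : ent μ (fun ω => (X ω, Z ω)) = _ := ent_comp (μ := μ) hW fun w => (w.1, w.2.2)
  have e4 : ent μ (fun ω => (Y ω, Z ω)) = _ := ent_comp (μ := μ) hW fun w => (w.2.1, w.2.2)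
  have m2 : ∀ w, mass μ W w ≤ mass μ Z w.2.2 :=
    mass_le_mass_comp (X := W) fun w : α × β × γ => w.2.2
  have m3 : ∀ w, mass μ W w ≤ mass μ (fun ω => (X ω, Z ω)) (w.1, w.2.2) :=
    mass_le_mass_comp (X := W) fun w : α × β × γ => (w.1, w.2.2)
  have m4 : ∀ w, mass μ W w ≤ mass μ (fun ω => (Y ω, Z ω)) (w.2.1, w.2.2) :=
    mass_le_mass_comp (X := W) fun w : α × β × γ => (w.2.1, w.2.2)
  simp only [hWdef] at e2 e3 e4
  rw [e1, e2, e3, e4, ← Finset.sum_add_distrib, ← Finset.sum_add_distrib]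
  refine Finset.sum_congr rfl fun w _ => ?_
  rw [← mul_add, ← mul_add]
  rcases (mass_nonneg (μ := μ) (X := W) w).eq_or_lt with h0 | h0
  · rw [← h0]; simp
  · have h2 := h0.trans_le (m2 w)
    have h3 := h0.trans_le (m3 w)
    have h4 := h0.trans_le (m4 w)
    have := congrArg Real.log (h w.1 w.2.1 w.2.2)
    rw [Real.log_mul h0.ne' h2.ne', Real.log_mul h3.ne' h4.ne'] at this
    rw [← neg_add, ← neg_add]
    exact congrArg (fun t => mass μ W w * -t) this

/-- Taking a constant for the conditioning variable turns the conditional statements above into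
`ent_prod_le` and `ent_prod_of_indep`. -/
theorem ent_unit [IsProbabilityMeasure μ] : ent μ (fun _ => ()) = 0 := by
  simp [ent, mass]

theorem mass_prod_unit (x : α) : mass μ (fun ω => (X ω, ())) (x, ()) = mass μ X x := by
  unfold mass; congr 1; ext ω; simp

theorem mass_prod_prod_unit (x : α) (y : β) :
    mass μ (fun ω => (X ω, Y ω, ())) (x, y, ()) = mass μ (fun ω => (X ω, Y ω)) (x, y) := by
  unfold mass; congr 1; ext ω; simp

theorem ent_prod_unit : ent μ (fun ω => (X ω, ())) = ent μ X := by
  simp only [ent, Fintype.sum_prod_type, Finset.univ_unique, Finset.sum_singleton]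
  exact Finset.sum_congr rfl fun x _ => congrArg _ (mass_prod_unit x)

theorem ent_prod_prod_unit :
    ent μ (fun ω => (X ω, Y ω, ())) = ent μ (fun ω => (X ω, Y ω)) := by
  simp only [ent, Fintype.sum_prod_type, Finset.univ_unique, Finset.sum_singleton]
  exact Finset.sum_congr rfl fun x _ => Finset.sum_congr rfl fun y _ =>
    congrArg _ (mass_prod_prod_unit x y)

theorem ent_prod_le [IsProbabilityMeasure μ] (hX : Measurable X) (hY : Measurable Y) :
    ent μ (fun ω => (X ω, Y ω)) ≤ ent μ X + ent μ Y := by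
  have := ent_submodular (μ := μ) hX hY (measurable_const (a := ()))
  rwa [ent_unit, ent_prod_unit, ent_prod_unit, ent_prod_prod_unit, add_zero] at this

theorem ent_prod_of_indep [IsProbabilityMeasure μ] (hX : Measurable X) (hY : Measurable Y)
    (h : ∀ x y, mass μ (fun ω => (X ω, Y ω)) (x, y) = mass μ X x * mass μ Y y) :
    ent μ (fun ω => (X ω, Y ω)) = ent μ X + ent μ Y := by
  have := ent_add_of_condIndep (μ := μ) hX hY (measurable_const (a := ())) fun x y z => by
    rw [mass_prod_prod_unit, mass_prod_unit, mass_prod_unit, h]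
    simp [mass]
  rwa [ent_unit, ent_prod_unit, ent_prod_unit, ent_prod_prod_unit, add_zero] at this

/-- The entropy is at most the logarithm of the number of values. -/
theorem ent_le_log_card [IsProbabilityMeasure μ] (hX : Measurable X) :
    ent μ X ≤ Real.log (Fintype.card α) := by
  obtain ⟨ω₀⟩ : Nonempty Ω := nonempty_of_isProbabilityMeasure μ
  have hc : (0 : ℝ) < Fintype.card α := by
    exact_mod_cast Fintype.card_pos_iff.2 ⟨X ω₀⟩
  have key : ∀ x, mass μ X x * -Real.log (mass μ X x) ≤
      (Fintype.card α : ℝ)⁻¹ - mass μ X x + mass μ X x * Real.log (Fintype.card α) := by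
    intro x
    rcases (mass_nonneg (μ := μ) (X := X) x).eq_or_lt with h | h
    · rw [← h]; simp
    · have := mul_log_div_le h (inv_pos.2 hc)
      rw [Real.log_inv] at this
      linarith
  rw [ent_eq_sum hX]
  refine (Finset.sum_le_sum fun x _ => key x).trans_eq ?_
  rw [Finset.sum_add_distrib, Finset.sum_sub_distrib, ← Finset.sum_mul, sum_mass hX]
  simp [hc.ne']

/-- Fano's inequality, with the error probability `μ.real {ω | Y ω ≠ X ω}`. -/
theorem ent_fano [IsProbabilityMeasure μ] {Y : Ω → α} (hX : Measurable X) (hY : Measurable Y) :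
    ent μ (fun ω => (X ω, Y ω)) ≤ ent μ Y + Real.log 2 +
      μ.real {ω | Y ω ≠ X ω} * Real.log (Fintype.card α) := by
  classical
  obtain ⟨ω₀⟩ : Nonempty Ω := nonempty_of_isProbabilityMeasure μ
  have hc : (0 : ℝ) < Fintype.card α := by
    exact_mod_cast Fintype.card_pos_iff.2 ⟨X ω₀⟩
  have hW : Measurable fun ω => (X ω, Y ω) := hX.prodMk hY
  set W : Ω → α × α := fun ω => (X ω, Y ω) with hWdef
  set N : ℝ := (Fintype.card α : ℝ) with hN
  have e1 := ent_eq_sum (μ := μ) hW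
  have e2 : ent μ Y = _ := ent_comp (μ := μ) hW fun w => w.2
  have m2 : ∀ w, mass μ W w ≤ mass μ Y w.2 := mass_le_mass_comp (X := W) fun w : α × α => w.2
  simp only [hWdef] at e2
  -- A guess of x from y: weight 1/2 on x = y, and 1/(2N) on every other value, so that the total
  -- over x is at most one and an error costs an extra log N.
  let r : α × α → ℝ := fun w => if w.2 ≠ w.1 then 2⁻¹ * N⁻¹ else 2⁻¹
  have hr : ∀ w, 0 < r w := fun w => by
    dsimp only [r]; split_ifs <;> positivity
  have hlogr : ∀ w, -Real.log (r w) = Real.log 2 + if w.2 ≠ w.1 then Real.log N else 0 := fun w => by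
    dsimp only [r]
    split_ifs
    · rw [Real.log_mul (by norm_num) (inv_ne_zero hc.ne'), Real.log_inv, Real.log_inv]; ring
    · rw [Real.log_inv]; ring
  have key : ∀ w, mass μ W w * -Real.log (mass μ W w) - mass μ W w * -Real.log (mass μ Y w.2) ≤
      mass μ Y w.2 * r w - mass μ W w + (mass μ W w * Real.log 2 +
        (if w.2 ≠ w.1 then mass μ W w else 0) * Real.log N) := by
    intro w
    have hw : (if w.2 ≠ w.1 then mass μ W w else 0) * Real.log N =
      mass μ W w * if w.2 ≠ w.1 then Real.log N else 0 := by split_ifs <;> simp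
    rw [hw, ← mul_add, ← hlogr]
    rcases (mass_nonneg (μ := μ) (X := W) w).eq_or_lt with h | h
    · rw [← h]
      simp only [zero_mul, sub_zero, add_zero]
      exact mul_nonneg (mass_nonneg _) (hr w).le
    · have h2 := h.trans_le (m2 w)
      have := mul_log_div_le h (mul_pos h2 (hr w))
      rw [Real.log_mul h2.ne' (hr w).ne'] at this
      linarith
  have tot : ∑ w : α × α, mass μ Y w.2 * r w ≤ 1 := by
    rw [← sum_mass (μ := μ) hY, Fintype.sum_prod_type_right]
    refine Finset.sum_le_sum fun y _ => ?_
    change ∑ x, mass μ Y y * r (x, y) ≤ _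
    rw [← Finset.mul_sum]
    refine mul_le_of_le_one_right (mass_nonneg _) ?_
    calc ∑ x, r (x, y) ≤ ∑ x, (2⁻¹ * N⁻¹ + if x = y then 2⁻¹ else 0) := by
          refine Finset.sum_le_sum fun x _ => ?_
          have : 0 < 2⁻¹ * N⁻¹ := by positivity
          by_cases hxy : x = y
          · simp [r, hxy, this.le]
          · simp [r, hxy, Ne.symm hxy]
      _ = 1 := by
          rw [Finset.sum_add_distrib]
          simp only [Finset.sum_const, Finset.card_univ, nsmul_eq_mul, Finset.sum_ite_eq',
            Finset.mem_univ, if_true, ← hN]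
          field_simp
          norm_num
  have err : ∑ w : α × α, (if w.2 ≠ w.1 then mass μ W w else 0) = μ.real {ω | Y ω ≠ X ω} := by
    rw [← Finset.sum_filter]
    unfold mass
    rw [sum_measureReal_preimage_singleton _ fun x _ => hW (measurableSet_singleton x)]
    congr 1
    ext ω
    simp [hWdef]
  have := Finset.sum_le_sum fun w (_ : w ∈ Finset.univ) => key w
  simp only [Finset.sum_sub_distrib, Finset.sum_add_distrib, ← Finset.sum_mul, sum_mass hW, err]
    at this
  rw [e1, e2]
  linarith

/-- If `X` and `Z` are conditionally independent given `Y`, then `Y` leaves no more uncertainty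
about `X` than `Z` does. -/
theorem condEnt_le_of_condIndep [IsProbabilityMeasure μ] (hX : Measurable X) (hY : Measurable Y)
    (hZ : Measurable Z)
    (h : ent μ (fun ω => (X ω, Z ω, Y ω)) + ent μ Y =
      ent μ (fun ω => (X ω, Y ω)) + ent μ (fun ω => (Z ω, Y ω))) :
    ent μ (fun ω => (X ω, Y ω)) - ent μ Y ≤ ent μ (fun ω => (X ω, Z ω)) - ent μ Z := by
  -- In conditional entropies: H(X | Y) = H(X | Y, Z) ≤ H(X | Z).
  have h1 := ent_submodular (μ := μ) hX hY hZ
  have h2 : ent μ (fun ω => (X ω, Z ω, Y ω)) ≤ ent μ (fun ω => (X ω, Y ω, Z ω)) :=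
    ent_comp_le (hX.prodMk (hY.prodMk hZ)) fun w => (w.1, w.2.2, w.2.1)
  have h3 : ent μ (fun ω => (Y ω, Z ω)) ≤ ent μ (fun ω => (Z ω, Y ω)) :=
    ent_comp_le (hZ.prodMk hY) fun w => (w.2, w.1)
  linarith

/-- Entropy is additive for random variables with zero mutual information. -/
theorem ent_prod_of_mutualInfo_eq_zero [IsProbabilityMeasure μ] (hX : Measurable X)
    (hY : Measurable Y) (h : mutualInfo μ X Y = 0) :
    ent μ (fun ω => (X ω, Y ω)) = ent μ X + ent μ Y := by
  have : IsProbabilityMeasure (μ.map X) := Measure.isProbabilityMeasure_map hX.aemeasurable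
  have : IsProbabilityMeasure (μ.map Y) := Measure.isProbabilityMeasure_map hY.aemeasurable
  have : IsProbabilityMeasure (μ.map fun ω => (X ω, Y ω)) :=
    Measure.isProbabilityMeasure_map (hX.prodMk hY).aemeasurable
  have hm := InformationTheory.klDiv_eq_zero_iff.1 h
  refine ent_prod_of_indep hX hY fun x y => ?_
  have hxy := congrArg (fun ν => ν.real ({x} ×ˢ {y})) hm
  simp only [measureReal_prod_prod] at hxy
  rw [map_measureReal_apply (hX.prodMk hY)
      ((measurableSet_singleton x).prod (measurableSet_singleton y)),
    map_measureReal_apply hX (measurableSet_singleton x),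
    map_measureReal_apply hY (measurableSet_singleton y), Set.singleton_prod_singleton] at hxy
  exact hxy

end entropy

/-! ### Measurability and conditional independence of the symbols of a code -/

namespace Code

variable {V E : Type} {N : Network V E} {q n : ℕ}

instance [Fintype V] (C : Code.{u} N q n) (p : PMF (Fin n → Fin q)) :
    IsProbabilityMeasure (C.outcomeLaw p) := by
  unfold outcomeLaw; infer_instance

theorem measurable_signal [Finite E] (C : Code.{u} N q n) (e : E) : Measurable (C.signal e) := by
  induction h : N.rank (N.tail e) using Nat.strong_induction_on generalizing e with
  | _ r ih =>
    have hinc : Measurable fun (ω : C.Outcome) (d : {d : E // N.head d = N.tail e}) =>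
        C.signal d.1 ω := measurable_pi_iff.2 fun d => by
      have hd := N.rank_lt d.1
      rw [d.2, h] at hd
      exact ih _ hd d.1 rfl
    -- Source blocks and incoming symbols take finitely many values, so measurability in the key
    -- alone suffices.
    have henc : Measurable fun t : ((Fin n → Fin q) ×
        ({d : E // N.head d = N.tail e} → Fin (2 ^ n))) × C.Key (N.tail e) =>
        C.enc e (fun _ => t.1.1) t.1.2 t.2 :=
      measurable_from_prod_countable_right fun t => C.enc_measurable e (fun _ => t.1) t.2
    have : C.signal e = fun ω => C.enc e (fun _ => ω.1) (fun d => C.signal d.1 ω)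
        (ω.2 (N.tail e)) := by
      funext ω; rw [signal]
    rw [this]
    exact henc.comp ((measurable_fst.prodMk hinc).prodMk
      ((measurable_pi_apply (N.tail e)).comp measurable_snd))

theorem measurable_observed [Finite E] (C : Code.{u} N q n) (A : Finset E) :
    Measurable (C.observed A) :=
  measurable_pi_iff.2 fun e => C.measurable_signal e.1

theorem measurable_decoded [Finite E] (C : Code.{u} N q n) : Measurable C.decoded :=
  (Measurable.of_discrete (f := C.dec)).comp
    (measurable_pi_iff.2 fun d => C.measurable_signal d.1)

/-- The symbol on a link is determined by the source block, if the link leaves the source, the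
symbols that enter its tail and the key of its tail. -/
theorem signal_congr (C : Code.{u} N q n) {e : E} {ω ω' : C.Outcome}
    (hsrc : N.tail e = N.source → ω.1 = ω'.1)
    (hinc : ∀ d, N.head d = N.tail e → C.signal d ω = C.signal d ω')
    (hkey : ω.2 (N.tail e) = ω'.2 (N.tail e)) : C.signal e ω = C.signal e ω' := by
  rw [signal, signal, hkey]
  congr 1
  · funext h; exact hsrc h
  · funext d; exact hinc d.1 d.2

theorem decoded_congr (C : Code.{u} N q n) {ω ω' : C.Outcome}
    (hinc : ∀ d, N.head d = N.sink → C.signal d ω = C.signal d ω') :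
    C.decoded ω = C.decoded ω' := by
  unfold decoded
  congr 1
  funext d; exact hinc d.1 d.2

/-- Events that depend on the keys in `I` are independent of events that depend on the source block
and the other keys. -/
theorem outcomeLaw_inter [Fintype V] (C : Code.{u} N q n) (p : PMF (Fin n → Fin q)) (I : Set V)
    {A B : Set C.Outcome} (hA : MeasurableSet A) (hB : MeasurableSet B)
    (hAI : ∀ ω ω' : C.Outcome, (∀ v ∈ I, ω.2 v = ω'.2 v) → ω ∈ A → ω' ∈ A)
    (hBI : ∀ ω ω' : C.Outcome, ω.1 = ω'.1 → (∀ v ∉ I, ω.2 v = ω'.2 v) → ω ∈ B → ω' ∈ B) :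
    C.outcomeLaw p (A ∩ B) = C.outcomeLaw p A * C.outcomeLaw p B := by
  classical
  obtain ⟨ω₀⟩ : Nonempty C.Outcome := nonempty_of_isProbabilityMeasure (C.outcomeLaw p)
  let J : V → Prop := fun v => v ∈ I
  let e := MeasurableEquiv.piEquivPiSubtypeProd C.Key J
  let πI := Measure.pi fun v : {v // J v} => C.keyLaw v
  let πJ := Measure.pi fun v : {v // ¬ J v} => C.keyLaw v
  -- The product is regrouped as (keys in `I`) × (source block and other keys), where the two events
  -- become cylinders over different factors.
  have h1 : MeasurePreserving (Prod.map id e : C.Outcome → _) (C.outcomeLaw p)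
      (p.toMeasure.prod (πI.prod πJ)) :=
    (MeasurePreserving.id _).prod (measurePreserving_piEquivPiSubtypeProd C.keyLaw J)
  have h2 := (measurePreserving_prodAssoc p.toMeasure πI πJ).symm
  have h3 : MeasurePreserving (Prod.map Prod.swap id) ((p.toMeasure.prod πI).prod πJ)
      ((πI.prod p.toMeasure).prod πJ) :=
    (Measure.measurePreserving_swap).prod (MeasurePreserving.id _)
  have h4 := measurePreserving_prodAssoc πI p.toMeasure πJ
  have hΨ := h4.comp (h3.comp (h2.comp h1))
  set Ψ := MeasurableEquiv.prodAssoc ∘ Prod.map Prod.swap id ∘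
    MeasurableEquiv.prodAssoc.symm ∘ (Prod.map id e : C.Outcome → _) with hΨdef
  have eΨ : ∀ ω : C.Outcome, Ψ ω = ((e ω.2).1, ω.1, (e ω.2).2) := fun ω => rfl
  have e1 : ∀ (k : (v : V) → C.Key v) v, (e k).1 v = k v := fun k v => rfl
  have e2 : ∀ (k : (v : V) → C.Key v) v, (e k).2 v = k v := fun k v => rfl
  -- Coordinates that an event ignores are frozen at their values in `ω₀`.
  let A' : Set ((v : {v // J v}) → C.Key v) :=
    {k | (ω₀.1, e.symm (k, (e ω₀.2).2)) ∈ A}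
  let B' : Set ((Fin n → Fin q) × ((v : {v // ¬ J v}) → C.Key v)) :=
    {k | (k.1, e.symm ((e ω₀.2).1, k.2)) ∈ B}
  have hA' : MeasurableSet A' :=
    (measurable_const.prodMk (e.symm.measurable.comp (measurable_id.prodMk measurable_const))) hA
  have hB' : MeasurableSet B' :=
    (measurable_fst.prodMk (e.symm.measurable.comp (measurable_const.prodMk measurable_snd))) hB
  have s1 : ∀ a (v : {v // J v}), (e.symm a) v = a.1 v := fun a v =>
    congrFun (congrArg Prod.fst (e.apply_symm_apply a)) v
  have s2 : ∀ a (v : {v // ¬ J v}), (e.symm a) v = a.2 v := fun a v =>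
    congrFun (congrArg Prod.snd (e.apply_symm_apply a)) v
  have memA : ∀ ω : C.Outcome, ω ∈ A ↔ (Ψ ω).1 ∈ A' := fun ω =>
    ⟨hAI _ _ fun v hv => (s1 ((e ω.2).1, (e ω₀.2).2) ⟨v, hv⟩).symm,
      hAI _ _ fun v hv => s1 ((e ω.2).1, (e ω₀.2).2) ⟨v, hv⟩⟩
  have memB : ∀ ω : C.Outcome, ω ∈ B ↔ (Ψ ω).2 ∈ B' := fun ω =>
    ⟨hBI ω _ rfl fun v hv => (s2 ((e ω₀.2).1, (e ω.2).2) ⟨v, hv⟩).symm,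
      hBI _ ω rfl fun v hv => s2 ((e ω₀.2).1, (e ω.2).2) ⟨v, hv⟩⟩
  have iA : A = Ψ ⁻¹' (A' ×ˢ Set.univ) := by ext ω; simp [memA]
  have iB : B = Ψ ⁻¹' (Set.univ ×ˢ B') := by ext ω; simp [memB]
  have iAB : A ∩ B = Ψ ⁻¹' (A' ×ˢ B') := by ext ω; simp [memA, memB]
  rw [iAB, hΨ.measure_preimage (hA'.prod hB').nullMeasurableSet, iA, iB,
    hΨ.measure_preimage (hA'.prod .univ).nullMeasurableSet,
    hΨ.measure_preimage (MeasurableSet.univ.prod hB').nullMeasurableSet]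
  simp only [Measure.prod_prod, measure_univ, mul_one, one_mul]

/-! ### Markov chains produced by fresh keys -/

section markov

variable {α β γ : Type} [Fintype α] [Fintype β] [Fintype γ]
  [MeasurableSpace α] [MeasurableSpace β] [MeasurableSpace γ]
  [MeasurableSingletonClass α] [MeasurableSingletonClass β] [MeasurableSingletonClass γ]

/-- If `S` and `T` are functions of the source block and the keys outside `I`, and `U` is a function
of `T` and the keys in `I`, then `U` and `S` are conditionally independent given `T`. -/
theorem ent_add_of_fresh_keys [Fintype V] (C : Code.{u} N q n) (p : PMF (Fin n → Fin q))
    (I : Set V) {U : C.Outcome → α} {S : C.Outcome → β} {T : C.Outcome → γ}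
    (mU : Measurable U) (mS : Measurable S) (mT : Measurable T)
    (hS : ∀ ω ω' : C.Outcome, ω.1 = ω'.1 → (∀ v ∉ I, ω.2 v = ω'.2 v) → S ω = S ω')
    (hT : ∀ ω ω' : C.Outcome, ω.1 = ω'.1 → (∀ v ∉ I, ω.2 v = ω'.2 v) → T ω = T ω')
    (hU : ∀ ω ω' : C.Outcome, T ω = T ω' → (∀ v ∈ I, ω.2 v = ω'.2 v) → U ω = U ω') :
    ent (C.outcomeLaw p) (fun ω => (U ω, S ω, T ω)) + ent (C.outcomeLaw p) T =
      ent (C.outcomeLaw p) (fun ω => (U ω, T ω)) +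
        ent (C.outcomeLaw p) (fun ω => (S ω, T ω)) := by
  classical
  refine ent_add_of_condIndep mU mS mT fun u s t => ?_
  set μ := C.outcomeLaw p
  by_cases ht : ∃ ω₀, T ω₀ = t
  · obtain ⟨ω₀, rfl⟩ := ht
    -- On the event `T ω = t`, replacing everything but the keys in `I` by `ω₀` does not change `U`.
    -- There `U ω = u` becomes an event about the keys in `I` only, hence independent of `S` and
    -- `T`.
    let mix : C.Outcome → C.Outcome := fun ω => (ω₀.1, fun v => if v ∈ I then ω.2 v else ω₀.2 v)
    have mmix : Measurable mix := by
      refine measurable_const.prodMk (measurable_pi_iff.2 fun v => ?_)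
      by_cases hv : v ∈ I
      · simp only [hv, if_true]
        exact (measurable_pi_apply v).comp measurable_snd
      · simp [hv]
    have Tmix : ∀ ω, T (mix ω) = T ω₀ := fun ω =>
      hT _ _ rfl fun v hv => by simp [mix, hv]
    have Umix : ∀ ω, T ω = T ω₀ → U (mix ω) = U ω := fun ω h =>
      hU _ _ ((Tmix ω).trans h.symm) fun v hv => by simp [mix, hv]
    let A : Set C.Outcome := {ω | U (mix ω) = u}
    have hA : MeasurableSet A := (mU.comp mmix) (measurableSet_singleton u)
    have hAI : ∀ ω ω' : C.Outcome, (∀ v ∈ I, ω.2 v = ω'.2 v) → ω ∈ A → ω' ∈ A := by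
      intro ω ω' h hω
      have : U (mix ω') = U (mix ω) :=
        hU _ _ ((Tmix ω').trans (Tmix ω).symm) fun v hv => by simp [mix, hv, h v hv]
      exact this.trans hω
    have f1 : mass μ (fun ω => (U ω, S ω, T ω)) (u, s, T ω₀) =
        μ.real A * mass μ (fun ω => (S ω, T ω)) (s, T ω₀) := by
      unfold mass
      have : (fun ω => (U ω, S ω, T ω)) ⁻¹' {(u, s, T ω₀)} =
          A ∩ (fun ω => (S ω, T ω)) ⁻¹' {(s, T ω₀)} := by
        ext ω
        simp only [Set.mem_preimage, Set.mem_singleton_iff, Prod.mk.injEq, Set.mem_inter_iff, A,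
          Set.mem_ofPred_eq]
        exact ⟨fun h => ⟨(Umix ω h.2.2).trans h.1, h.2⟩,
          fun h => ⟨(Umix ω h.2.2).symm.trans h.1, h.2⟩⟩
      rw [this, Measure.real, C.outcomeLaw_inter p I hA
        ((mS.prodMk mT) (measurableSet_singleton _)) hAI, ENNReal.toReal_mul]
      · rfl
      · intro ω ω' h h' hω
        simp only [Set.mem_preimage, Set.mem_singleton_iff, Prod.mk.injEq] at hω ⊢
        rwa [← hS ω ω' h h', ← hT ω ω' h h']
    have f2 : mass μ (fun ω => (U ω, T ω)) (u, T ω₀) = μ.real A * mass μ T (T ω₀) := by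
      unfold mass
      have : (fun ω => (U ω, T ω)) ⁻¹' {(u, T ω₀)} = A ∩ T ⁻¹' {T ω₀} := by
        ext ω
        simp only [Set.mem_preimage, Set.mem_singleton_iff, Prod.mk.injEq, Set.mem_inter_iff, A,
          Set.mem_ofPred_eq]
        exact ⟨fun h => ⟨(Umix ω h.2).trans h.1, h.2⟩,
          fun h => ⟨(Umix ω h.2).symm.trans h.1, h.2⟩⟩
      rw [this, Measure.real, C.outcomeLaw_inter p I hA
        (mT (measurableSet_singleton _)) hAI, ENNReal.toReal_mul]
      · rfl
      · intro ω ω' h h' hω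
        simp only [Set.mem_preimage, Set.mem_singleton_iff] at hω ⊢
        rwa [← hT ω ω' h h']
    rw [f1, f2]; ring
  · have z1 : mass μ T t = 0 := by
      have : T ⁻¹' {t} = ∅ := by
        ext ω; simp only [Set.mem_preimage, Set.mem_singleton_iff, Set.mem_empty_iff_false,
          iff_false]; exact fun h => ht ⟨ω, h⟩
      simp [mass, this]
    have z2 : mass μ (fun ω => (U ω, T ω)) (u, t) = 0 := by
      have : (fun ω => (U ω, T ω)) ⁻¹' {(u, t)} = ∅ := by
        ext ω; simp only [Set.mem_preimage, Set.mem_singleton_iff, Set.mem_empty_iff_false,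
          iff_false, Prod.mk.injEq]; exact fun h => ht ⟨ω, h.2⟩
      simp [mass, this]
    rw [z1, z2]; ring

/-- Data processing: `T` leaves no more uncertainty about `S` than `U` does, if `U` is a function of
`T` and fresh keys. -/
theorem condEnt_le_of_processed [Fintype V] (C : Code.{u} N q n) (p : PMF (Fin n → Fin q))
    (I : Set V) {U : C.Outcome → α} {S : C.Outcome → β} {T : C.Outcome → γ}
    (mU : Measurable U) (mS : Measurable S) (mT : Measurable T)
    (hS : ∀ ω ω' : C.Outcome, ω.1 = ω'.1 → (∀ v ∉ I, ω.2 v = ω'.2 v) → S ω = S ω')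
    (hT : ∀ ω ω' : C.Outcome, ω.1 = ω'.1 → (∀ v ∉ I, ω.2 v = ω'.2 v) → T ω = T ω')
    (hU : ∀ ω ω' : C.Outcome, T ω = T ω' → (∀ v ∈ I, ω.2 v = ω'.2 v) → U ω = U ω') :
    ent (C.outcomeLaw p) (fun ω => (S ω, T ω)) - ent (C.outcomeLaw p) T ≤
      ent (C.outcomeLaw p) (fun ω => (S ω, U ω)) - ent (C.outcomeLaw p) U := by
  have h := C.ent_add_of_fresh_keys p I mU mS mT hS hT hU
  refine condEnt_le_of_condIndep mS mT mU ?_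
  have h1 : ent (C.outcomeLaw p) (fun ω => (S ω, U ω, T ω)) =
      ent (C.outcomeLaw p) (fun ω => (U ω, S ω, T ω)) :=
    le_antisymm (ent_comp_le (mU.prodMk (mS.prodMk mT)) fun w => (w.2.1, w.1, w.2.2))
      (ent_comp_le (mS.prodMk (mU.prodMk mT)) fun w => (w.2.1, w.1, w.2.2))
  linarith

/-- `T` leaves no more uncertainty about `U` than `S` does, if `U` is a function of `T` and keys
that are fresh to `S` and `T`. -/
theorem condEnt_le_of_fresh_keys [Fintype V] (C : Code.{u} N q n) (p : PMF (Fin n → Fin q))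
    (I : Set V) {U : C.Outcome → α} {S : C.Outcome → β} {T : C.Outcome → γ}
    (mU : Measurable U) (mS : Measurable S) (mT : Measurable T)
    (hS : ∀ ω ω' : C.Outcome, ω.1 = ω'.1 → (∀ v ∉ I, ω.2 v = ω'.2 v) → S ω = S ω')
    (hT : ∀ ω ω' : C.Outcome, ω.1 = ω'.1 → (∀ v ∉ I, ω.2 v = ω'.2 v) → T ω = T ω')
    (hU : ∀ ω ω' : C.Outcome, T ω = T ω' → (∀ v ∈ I, ω.2 v = ω'.2 v) → U ω = U ω') :
    ent (C.outcomeLaw p) (fun ω => (U ω, T ω)) - ent (C.outcomeLaw p) T ≤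
      ent (C.outcomeLaw p) (fun ω => (U ω, S ω)) - ent (C.outcomeLaw p) S :=
  condEnt_le_of_condIndep mU mT mS (C.ent_add_of_fresh_keys p I mU mS mT hS hT hU)

end markov

/-! ### Entropies of the source block and of the observed links -/

variable [Fintype V] [Fintype E] [DecidableEq E]

set_option linter.unusedSectionVars false

theorem observed_eq_iff (C : Code.{u} N q n) {A : Finset E} {ω ω' : C.Outcome} :
    C.observed A ω = C.observed A ω' ↔ ∀ e ∈ A, C.signal e ω = C.signal e ω' :=
  ⟨fun h e he => congrFun h ⟨e, he⟩, fun h => funext fun e => h e.1 e.2⟩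

theorem ent_observed_le_card (C : Code.{u} N q n) (p : PMF (Fin n → Fin q)) (A : Finset E) :
    ent (C.outcomeLaw p) (C.observed A) ≤ A.card * (n * Real.log 2) := by
  refine (ent_le_log_card (C.measurable_observed A)).trans_eq ?_
  simp

theorem ent_observed_union_le (C : Code.{u} N q n) (p : PMF (Fin n → Fin q))
    (A B : Finset E) : ent (C.outcomeLaw p) (C.observed (A ∪ B)) ≤
      ent (C.outcomeLaw p) (C.observed A) + ent (C.outcomeLaw p) (C.observed B) := by
  refine le_trans (ent_le_of_determines
    ((C.measurable_observed A).prodMk (C.measurable_observed B)) fun ω ω' h => ?_)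
    (ent_prod_le (C.measurable_observed A) (C.measurable_observed B))
  rw [Prod.mk.injEq, observed_eq_iff, observed_eq_iff] at h
  rw [observed_eq_iff]
  intro e he
  exact (Finset.mem_union.1 he).elim (h.1 e) (h.2 e)

theorem mass_message (C : Code.{u} N q n) (p : PMF (Fin n → Fin q)) (x : Fin n → Fin q) :
    mass (C.outcomeLaw p) (fun ω => ω.1) x = (p x).toReal := by
  have : (fun ω : C.Outcome => ω.1) ⁻¹' {x} = {x} ×ˢ Set.univ := by ext ω; simp
  rw [mass, this, Measure.real, outcomeLaw, Measure.prod_prod, measure_univ, mul_one,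
    PMF.toMeasure_apply_singleton _ _ (measurableSet_singleton x)]

theorem ent_message (C : Code.{u} N q n) (p : PMF (Fin n → Fin q)) :
    ent (C.outcomeLaw p) (fun ω => ω.1) = entropyBits p * Real.log 2 := by
  have : Real.log 2 ≠ 0 := (Real.log_pos (by norm_num)).ne'
  rw [entropyBits, div_mul_cancel₀ _ this]
  exact Finset.sum_congr rfl fun x _ => congrArg _ (C.mass_message p x)

/-- Secrecy from the links in `A` implies independence of the source block from the symbols on any
subset of `A`. -/
theorem IsSecret.ent_message_observed {C : Code.{u} N q n} {p : PMF (Fin n → Fin q)}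
    {W : Set (Finset E)} (h : C.IsSecret p W) {A B : Finset E} (hA : A ∈ W) (hBA : B ⊆ A) :
    ent (C.outcomeLaw p) (fun ω => (ω.1, C.observed B ω)) =
      ent (C.outcomeLaw p) (fun ω => ω.1) + ent (C.outcomeLaw p) (C.observed B) := by
  have mA := C.measurable_observed A
  have mB := C.measurable_observed B
  have mM : Measurable fun ω : C.Outcome => ω.1 := measurable_fst
  refine le_antisymm (ent_prod_le mM mB) ?_
  have h1 := ent_prod_of_mutualInfo_eq_zero mM mA (h A hA)
  -- H(M | B) ≥ H(M | A) = H(M), because `A` determines `B`.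
  have h2 := ent_submodular (μ := C.outcomeLaw p) mM mA mB
  have h3 : ent (C.outcomeLaw p) (fun ω => (ω.1, C.observed A ω)) ≤
      ent (C.outcomeLaw p) (fun ω => (ω.1, C.observed A ω, C.observed B ω)) :=
    ent_comp_le (mM.prodMk (mA.prodMk mB)) fun w => (w.1, w.2.1)
  have h4 : ent (C.outcomeLaw p) (fun ω => (C.observed A ω, C.observed B ω)) ≤
      ent (C.outcomeLaw p) (C.observed A) := by
    refine ent_le_of_determines mA fun ω ω' hω => Prod.ext hω ?_
    rw [observed_eq_iff] at hω ⊢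
    exact fun e he => hω e (hBA he)
  linarith

end Code

/-! ### Dependence of symbols on upstream keys and on cuts -/

namespace Code

variable {V E : Type} {N : Network V E} {q n : ℕ}

/-- The symbols on a set of links that is closed under predecessors and has no tails in `I` do not
depend on the keys in `I`. -/
theorem signal_eq_of_upstream (C : Code.{u} N q n) {I : Finset V} {P : Finset E}
    (hP : ∀ e ∈ P, N.tail e ∉ I ∧ ∀ d, N.head d = N.tail e → d ∈ P) {ω ω' : C.Outcome}
    (hsrc : ω.1 = ω'.1) (hkey : ∀ v ∉ I, ω.2 v = ω'.2 v) {e : E} (he : e ∈ P) :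
    C.signal e ω = C.signal e ω' := by
  induction h : N.rank (N.tail e) using Nat.strong_induction_on generalizing e with
  | _ r ih =>
    refine C.signal_congr (fun _ => hsrc) (fun d hd => ?_) (hkey _ (hP e he).1)
    have hr := N.rank_lt d
    rw [hd, h] at hr
    exact ih _ hr ((hP e he).2 d hd) rfl

/-- The symbols downstream of the links in `cut` are functions of the symbols on `cut` and of the
keys in `I`. -/
theorem signal_eq_of_cut (C : Code.{u} N q n) {I : Finset V} {cut P : Finset E}
    (hP : ∀ e ∈ P, e ∈ cut ∨
      (N.tail e ≠ N.source ∧ N.tail e ∈ I ∧ ∀ d, N.head d = N.tail e → d ∈ P))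
    {ω ω' : C.Outcome} (hcut : ∀ e ∈ cut, C.signal e ω = C.signal e ω')
    (hkey : ∀ v ∈ I, ω.2 v = ω'.2 v) {e : E} (he : e ∈ P) :
    C.signal e ω = C.signal e ω' := by
  induction h : N.rank (N.tail e) using Nat.strong_induction_on generalizing e with
  | _ r ih =>
    rcases hP e he with hc | ⟨hs, hI, hd'⟩
    · exact hcut e hc
    · refine C.signal_congr (fun h => absurd h hs) (fun d hd => ?_) (hkey _ hI)
      have hr := N.rank_lt d
      rw [hd, h] at hr
      exact ih _ hr (hd' d hd) rfl

end Code

instance : Fintype Link where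
  elems := {.z1, .z2, .z3, .a_t1, .c_t1, .a_t3, .b_t3, .l1, .l2, .l3, .l4, .l5,
    .h1_e, .h1_g, .h2_e, .h2_f, .h4_f, .h4_g, .l6, .l7, .l8}
  complete := by intro l; cases l <;> decide

instance (l : Link) (v : Node) : Decidable (fiveLinkNetwork.head l = v) :=
  inferInstanceAs (Decidable (l.ends.2 = v))

/-- The links that leave the source. -/
def firstLayer : Finset Link := {.z1, .z2, .z3}

/-- The nodes downstream of the middle layer, except for the sink. -/
def innerNodes : Finset Node := {.h1, .h2, .h4, .e, .f, .g}

/-! ### The converse: entropy inequalities for the five-link network -/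

section converse

variable {q n : ℕ} (C : Code.{u} fiveLinkNetwork q n) (p : PMF (Fin n → Fin q))

/-- The links of the first layer leave no more uncertainty about the source block than the
reconstruction at the sink does. -/
theorem condEnt_message_firstLayer_le :
    ent (C.outcomeLaw p) (fun ω => (ω.1, C.observed firstLayer ω)) -
        ent (C.outcomeLaw p) (C.observed firstLayer) ≤
      ent (C.outcomeLaw p) (fun ω => (ω.1, C.decoded ω)) - ent (C.outcomeLaw p) C.decoded := by
  refine C.condEnt_le_of_processed p (({.s}ᶜ : Finset Node) : Set Node) C.measurable_decoded
    measurable_fst (C.measurable_observed _) (fun ω ω' h _ => h) (fun ω ω' h hk => ?_)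
    fun ω ω' hT hk => ?_
  · rw [Code.observed_eq_iff]
    intro e he
    exact C.signal_eq_of_upstream (I := {.s}ᶜ) (P := firstLayer) (by decide) h hk he
  · rw [Code.observed_eq_iff] at hT
    exact C.decoded_congr fun d _ => C.signal_eq_of_cut (I := {.s}ᶜ) (P := Finset.univ)
      (by decide) hT hk (Finset.mem_univ d)

/-- The links of the middle layer leave no more uncertainty about the source block than the
reconstruction at the sink does. -/
theorem condEnt_message_middleLayer_le :
    ent (C.outcomeLaw p) (fun ω => (ω.1, C.observed middleLayer ω)) -
        ent (C.outcomeLaw p) (C.observed middleLayer) ≤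
      ent (C.outcomeLaw p) (fun ω => (ω.1, C.decoded ω)) - ent (C.outcomeLaw p) C.decoded := by
  refine C.condEnt_le_of_processed p (innerNodes : Set Node)
    C.measurable_decoded measurable_fst (C.measurable_observed _) (fun ω ω' h _ => h)
    (fun ω ω' h hk => ?_) fun ω ω' hT hk => ?_
  · rw [Code.observed_eq_iff]
    intro e he
    refine C.signal_eq_of_upstream (I := innerNodes)
      (P := {.z1, .z2, .z3, .a_t1, .c_t1, .a_t3, .b_t3, .l1, .l2, .l3, .l4, .l5}) (by decide +kernel)
      h hk ?_
    revert e
    decide +kernel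
  · rw [Code.observed_eq_iff] at hT
    refine C.decoded_congr fun d hd => C.signal_eq_of_cut (I := innerNodes)
      (P := {.l1, .l2, .l3, .l4, .l5, .h1_e, .h1_g, .h2_e, .h2_f, .h4_f, .h4_g, .l6, .l7, .l8})
      (by decide +kernel) hT hk ?_
    have hl : ∀ d, fiveLinkNetwork.head d = .d → d = .l6 ∨ d = .l7 ∨ d = .l8 := by decide
    rcases hl d hd with rfl | rfl | rfl <;> decide

/-- Given the source block and the first layer, link 4 is at most as uncertain as given the source
block and links 1, 2 and 5, none of which depends on the key of the tail of link 4. -/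
theorem condEnt_l4_le :
    ent (C.outcomeLaw p) (fun ω => (C.observed {.l4} ω, ω.1, C.observed firstLayer ω)) -
        ent (C.outcomeLaw p) (fun ω => (ω.1, C.observed firstLayer ω)) ≤
      ent (C.outcomeLaw p) (fun ω => (C.observed {.l4} ω, ω.1, C.observed {.l1, .l2, .l5} ω)) -
        ent (C.outcomeLaw p) (fun ω => (ω.1, C.observed {.l1, .l2, .l5} ω)) := by
  refine C.condEnt_le_of_fresh_keys p (({.b} : Finset Node) : Set Node) (C.measurable_observed _)
    (measurable_fst.prodMk (C.measurable_observed _))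
    (measurable_fst.prodMk (C.measurable_observed _)) (fun ω ω' h hk => Prod.ext h ?_)
    (fun ω ω' h hk => Prod.ext h ?_) fun ω ω' hT hk => ?_
  -- `P` consists of links 1, 2, 5 and all their predecessors; none of them leaves `b`.
  · refine C.observed_eq_iff.2 fun e he => C.signal_eq_of_upstream (I := {.b})
      (P := {.z1, .z3, .a_t1, .c_t1, .l1, .l2, .l5}) (by decide) h hk ?_
    exact (by decide : ({.l1, .l2, .l5} : Finset Link) ⊆ _) he
  · exact C.observed_eq_iff.2 fun e he =>
      C.signal_eq_of_upstream (I := {.b}) (P := firstLayer) (by decide) h hk he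
  · refine C.observed_eq_iff.2 fun e he => C.signal_eq_of_cut (I := {.b}) (P := {.z2, .l4})
      (by decide) (C.observed_eq_iff.1 (Prod.mk.injEq _ _ _ _ ▸ hT).2) hk ?_
    exact (by decide : ({.l4} : Finset Link) ⊆ _) he

/-- Given the source block and the first layer, link 5 is at most as uncertain as given the source
block and links 2, 3 and 4, none of which depends on the key of the tail of link 5. -/
theorem condEnt_l5_le :
    ent (C.outcomeLaw p) (fun ω => (C.observed {.l5} ω, ω.1, C.observed firstLayer ω)) -
        ent (C.outcomeLaw p) (fun ω => (ω.1, C.observed firstLayer ω)) ≤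
      ent (C.outcomeLaw p) (fun ω => (C.observed {.l5} ω, ω.1, C.observed {.l2, .l3, .l4} ω)) -
        ent (C.outcomeLaw p) (fun ω => (ω.1, C.observed {.l2, .l3, .l4} ω)) := by
  refine C.condEnt_le_of_fresh_keys p (({.c} : Finset Node) : Set Node) (C.measurable_observed _)
    (measurable_fst.prodMk (C.measurable_observed _))
    (measurable_fst.prodMk (C.measurable_observed _)) (fun ω ω' h hk => Prod.ext h ?_)
    (fun ω ω' h hk => Prod.ext h ?_) fun ω ω' hT hk => ?_
  · refine C.observed_eq_iff.2 fun e he => C.signal_eq_of_upstream (I := {.c})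
      (P := {.z1, .z2, .a_t3, .b_t3, .l2, .l3, .l4}) (by decide) h hk ?_
    exact (by decide : ({.l2, .l3, .l4} : Finset Link) ⊆ _) he
  · exact C.observed_eq_iff.2 fun e he =>
      C.signal_eq_of_upstream (I := {.c}) (P := firstLayer) (by decide) h hk he
  · refine C.observed_eq_iff.2 fun e he => C.signal_eq_of_cut (I := {.c}) (P := {.z3, .l5})
      (by decide) (C.observed_eq_iff.1 (Prod.mk.injEq _ _ _ _ ▸ hT).2) hk ?_
    exact (by decide : ({.l5} : Finset Link) ⊆ _) he

/-- If the middle layer consists of the links in `A` and in `B`, and `A` reveals nothing about the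
source block, then the source block and `A` nearly determine the middle layer. -/
theorem ent_message_middleLayer_le {W : Set (Finset Link)} (h : C.IsSecret p W)
    {A B : Finset Link} (hA : A ∈ W) (hAB : middleLayer = A ∪ B) :
    ent (C.outcomeLaw p) (fun ω => (ω.1, C.observed middleLayer ω)) +
        ent (C.outcomeLaw p) (fun ω => ω.1) ≤
      ent (C.outcomeLaw p) (fun ω => (ω.1, C.observed A ω)) +
        ent (C.outcomeLaw p) (C.observed B) +
        (ent (C.outcomeLaw p) (fun ω => (ω.1, C.decoded ω)) -
          ent (C.outcomeLaw p) C.decoded) := by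
  -- H(M, L) ≤ H(L) + ε ≤ H(A) + H(B) + ε for the middle layer L, and secrecy gives H(A) = H(M, A) -
  -- H(M).
  have h1 := condEnt_message_middleLayer_le C p
  have h2 := C.ent_observed_union_le p A B
  rw [← hAB] at h2
  have h3 := h.ent_message_observed hA subset_rfl
  linarith

/-- A code that is secure against all wiretap sets carries at most 7/4 bits per time unit, up to the
uncertainty about the source block at the sink. -/
theorem four_mul_ent_message_le (h : C.IsSecret p wiretapSets) :
    4 * ent (C.outcomeLaw p) (fun ω => ω.1) ≤ 7 * (n * Real.log 2) +
      4 * (ent (C.outcomeLaw p) (fun ω => (ω.1, C.decoded ω)) -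
        ent (C.outcomeLaw p) C.decoded) := by
  have mM : Measurable fun ω : C.Outcome => ω.1 := measurable_fst
  have mO := C.measurable_observed
  have hW : ∀ A : Finset Link, A ⊆ middleLayer ∧ A.card = 3 → A ∈ wiretapSets := fun A hA => hA
  -- `a1` and `a2` use the wiretap sets that do not depend on the keys of `b` and of `c`; they bound
  -- H(L4 | M, Z) and H(L5 | M, Z) by 2h - H(M) + ε. `a3` yields H(L4, L5) ≥ H(M) - ε.
  have a1 := ent_message_middleLayer_le C p h (A := {.l1, .l2, .l5}) (B := {.l3, .l4})
    (hW _ (by decide)) (by decide)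
  have a2 := ent_message_middleLayer_le C p h (A := {.l2, .l3, .l4}) (B := {.l1, .l5})
    (hW _ (by decide)) (by decide)
  have a3 := ent_message_middleLayer_le C p h (A := {.l1, .l2, .l3}) (B := {.l4, .l5})
    (hW _ (by decide)) (by decide)
  have sub : ∀ {A : Finset Link}, A ⊆ middleLayer →
      ∀ ω ω' : C.Outcome, (ω.1, C.observed middleLayer ω) = (ω'.1, C.observed middleLayer ω') →
        ω.1 = ω'.1 ∧ C.observed A ω = C.observed A ω' := by
    intro A hA ω ω' hω
    rw [Prod.mk.injEq, Code.observed_eq_iff] at hω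
    exact ⟨hω.1, C.observed_eq_iff.2 fun e he => hω.2 e (hA he)⟩
  have b1 : ent (C.outcomeLaw p)
      (fun ω => (C.observed {.l4} ω, ω.1, C.observed {.l1, .l2, .l5} ω)) ≤
      ent (C.outcomeLaw p) (fun ω => (ω.1, C.observed middleLayer ω)) :=
    ent_le_of_determines (mM.prodMk (mO _)) fun ω ω' hω =>
      Prod.ext (sub (by decide) ω ω' hω).2
        (Prod.ext (sub (Finset.empty_subset _) ω ω' hω).1 (sub (by decide) ω ω' hω).2)
  have b2 : ent (C.outcomeLaw p)
      (fun ω => (C.observed {.l5} ω, ω.1, C.observed {.l2, .l3, .l4} ω)) ≤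
      ent (C.outcomeLaw p) (fun ω => (ω.1, C.observed middleLayer ω)) :=
    ent_le_of_determines (mM.prodMk (mO _)) fun ω ω' hω =>
      Prod.ext (sub (by decide) ω ω' hω).2
        (Prod.ext (sub (Finset.empty_subset _) ω ω' hω).1 (sub (by decide) ω ω' hω).2)
  have b3 : ent (C.outcomeLaw p) (fun ω => (ω.1, C.observed {.l1, .l2, .l3} ω)) ≤
      ent (C.outcomeLaw p) (fun ω => (ω.1, C.observed middleLayer ω)) :=
    ent_le_of_determines (mM.prodMk (mO _)) fun ω ω' hω =>
      Prod.ext (sub (Finset.empty_subset _) ω ω' hω).1 (sub (by decide) ω ω' hω).2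
  have c34 := C.ent_observed_le_card p {.l3, .l4}
  have c15 := C.ent_observed_le_card p {.l1, .l5}
  have cZ := C.ent_observed_le_card p firstLayer
  rw [show Finset.card ({.l3, .l4} : Finset Link) = 2 from rfl] at c34
  rw [show Finset.card ({.l1, .l5} : Finset Link) = 2 from rfl] at c15
  rw [show Finset.card firstLayer = 3 from rfl] at cZ
  push_cast at c34 c15 cZ
  have s45 := h.ent_message_observed (A := {.l2, .l4, .l5}) (B := {.l4, .l5})
    (hW _ (by decide)) (by decide)
  have d1 := condEnt_l4_le C p
  have d2 := condEnt_l5_le C p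
  have d3 := condEnt_message_firstLayer_le C p
  have d4 := ent_submodular (μ := C.outcomeLaw p) (mO {.l4}) (mO {.l5})
    (mM.prodMk (mO firstLayer))
  have d5 : ent (C.outcomeLaw p) (fun ω => (ω.1, C.observed {.l4, .l5} ω)) ≤
      ent (C.outcomeLaw p) (fun ω => (C.observed {.l4} ω, C.observed {.l5} ω, ω.1,
        C.observed firstLayer ω)) := by
    refine ent_le_of_determines
      ((mO _).prodMk ((mO _).prodMk (mM.prodMk (mO _)))) fun ω ω' hω => ?_
    simp only [Prod.mk.injEq, Code.observed_eq_iff, Finset.mem_insert, Finset.mem_singleton,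
      forall_eq, forall_eq_or_imp] at hω ⊢
    exact ⟨hω.2.2.1, hω.1, hω.2.1⟩
  -- H(M) + H(L4, L5) ≤ H(M, Z) + H(L4 | M, Z) + H(L5 | M, Z). The 7h is 3h from Z and 2h from each
  -- of `a1`, `a2`; the 4ε come from `a1`, `a2`, `a3`, `d3`.
  linarith

end converse

/-- Rate 2 is not achievable when the wiretap set is unknown. -/
theorem not_achievable_two :
    ¬ Network.Achievable.{u} fiveLinkNetwork wiretapSets 2 := by
  rintro ⟨X, hrate, C, hsec, herr⟩
  have hl : 0 < Real.log 2 := Real.log_pos (by norm_num)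
  have herr' : Tendsto (fun n => ((C n).errorProb (X.law n)).toReal * Real.log X.q + Real.log 2 / n)
      atTop (𝓝 0) := by
    have h1 := ((ENNReal.tendsto_toReal ENNReal.zero_ne_top).comp herr).mul_const (Real.log X.q)
    have h2 := tendsto_const_div_atTop_nhds_zero_nat (Real.log 2)
    simpa using h1.add h2
  -- A slack of 1/10 in both the Fano term and the rate is enough: 4 (2 - 1/10) = 7.6 exceeds 7 +
  -- 4/10.
  have hsmall := herr'.eventually (gt_mem_nhds (by positivity : 0 < Real.log 2 / 10))
  obtain ⟨n, hn, hr, hn0⟩ := (hsmall.and ((hrate (1 / 10) (by norm_num)).and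
    (eventually_gt_atTop 0))).exists
  have hn0' : (0 : ℝ) < n := by exact_mod_cast hn0
  have h1 := four_mul_ent_message_le (C n) (X.law n) (hsec n)
  have h2 := ent_fano (μ := (C n).outcomeLaw (X.law n)) (X := fun ω => ω.1) measurable_fst
    (C n).measurable_decoded
  have h3 : ((C n).outcomeLaw (X.law n)).real {ω | (C n).decoded ω ≠ ω.1} =
    ((C n).errorProb (X.law n)).toReal := rfl
  have h4 : Real.log (Fintype.card (Fin n → Fin X.q)) = n * Real.log X.q := by simp
  rw [h3, h4] at h2
  rw [Code.ent_message] at h1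
  rw [le_div_iff₀ hn0'] at hr
  have h5 := mul_lt_mul_of_pos_left hn hn0'
  rw [mul_add, mul_div_cancel₀ _ hn0'.ne'] at h5
  have h6 := mul_le_mul_of_nonneg_right hr hl.le
  have h7 : 0 < n * Real.log 2 := by positivity
  linarith

/-! ### Routing along link-disjoint paths -/

section routing

variable {V E : Type} {N : Network V E}

/-- The links in `P` connect the source to the sink: some link in `P` enters the sink, and every
link in `P` leaves the source or is preceded by a link in `P`. -/
def Network.Connects (N : Network V E) (P : Finset E) : Prop :=
  (∃ e ∈ P, N.head e = N.sink) ∧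
    ∀ e ∈ P, N.tail e = N.source ∨ ∃ d ∈ P, N.head d = N.tail e

/-- Otherwise induction along the topological order puts the head of every link of `P` in `S`,
including the sink. -/
theorem Network.Connects.exists_crossing {P : Finset E} (hP : N.Connects P) {S : Set V}
    (hs : N.source ∈ S) (hd : N.sink ∉ S) : ∃ e ∈ P, N.tail e ∈ S ∧ N.head e ∉ S := by
  by_contra! hno
  have key : ∀ r : ℕ, ∀ e ∈ P, N.rank (N.tail e) = r → N.head e ∈ S := by
    intro r
    induction r using Nat.strong_induction_on with
    | _ r ih =>
      intro e he hr
      refine hno e he ?_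
      rcases hP.2 e he with h | ⟨d, hdP, hde⟩
      · exact h ▸ hs
      · have := N.rank_lt d
        rw [hde, hr] at this
        exact hde ▸ ih _ this d hdP rfl
  obtain ⟨e, he, hes⟩ := hP.1
  exact hd (hes ▸ key _ e he rfl)

theorem Network.Connects.two_le_encard {P Q A : Finset E} (hP : N.Connects P) (hQ : N.Connects Q)
    (hPQ : Disjoint P Q) (hPA : Disjoint P A) (hQA : Disjoint Q A) {S : Set V}
    (hs : N.source ∈ S) (hd : N.sink ∉ S) :
    2 ≤ Set.encard {e : E | N.tail e ∈ S ∧ N.head e ∉ S ∧ e ∉ A} := by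
  obtain ⟨e, he, hte, hhe⟩ := hP.exists_crossing hs hd
  obtain ⟨f, hf, htf, hhf⟩ := hQ.exists_crossing hs hd
  have hef : e ≠ f := fun h => Finset.disjoint_left.1 hPQ he (h ▸ hf)
  rw [← Set.encard_pair hef]
  refine Set.encard_le_encard ?_
  rintro x (rfl | rfl)
  · exact ⟨hte, hhe, Finset.disjoint_left.1 hPA he⟩
  · exact ⟨htf, hhf, Finset.disjoint_left.1 hQA hf⟩

/-- A constant observation carries no information. -/
theorem mutualInfo_const {Ω : Type u} {α β : Type} [MeasurableSpace Ω] [MeasurableSpace α]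
    [MeasurableSpace β] {μ : Measure Ω} [IsProbabilityMeasure μ] {X : Ω → α} (hX : Measurable X)
    (b : β) : mutualInfo μ X (fun _ => b) = 0 := by
  have : IsProbabilityMeasure (μ.map X) := Measure.isProbabilityMeasure_map hX.aemeasurable
  have h : (μ.map fun ω => (X ω, b)) = (μ.map X).prod (μ.map fun _ => b) := by
    rw [Measure.map_const, measure_univ, one_smul, Measure.prod_dirac,
      Measure.map_map (by fun_prop) hX]
    rfl
  rw [mutualInfo, h, InformationTheory.klDiv_self]

/-- A source block over a four-letter alphabet as two messages of one bit per time unit each. -/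
noncomputable def splitBlock (n : ℕ) : (Fin n → Fin 4) ≃ Fin (2 ^ n) × Fin (2 ^ n) :=
  Fintype.equivOfCardEq (by simp [← mul_pow])

open Classical in
/-- The links in `P` forward the message `f x`, where `x` is the source block. -/
noncomputable def forward (N : Network V E) {n : ℕ} (P : Finset E)
    (f : (Fin n → Fin 4) → Fin (2 ^ n)) (e : E) (src : N.tail e = N.source → Fin n → Fin 4)
    (inc : {d : E // N.head d = N.tail e} → Fin (2 ^ n)) : Fin (2 ^ n) :=
  if h : N.tail e = N.source then f (src h)
  else if h : ∃ d ∈ P, N.head d = N.tail e then inc ⟨h.choose, h.choose_spec.2⟩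
  else ⟨0, by positivity⟩

open Classical in
/-- The code that sends the two halves of the source block along the links in `P` and in `Q`. -/
noncomputable def routingCode (n : ℕ) {P Q : Finset E} (hP : N.Connects P) (hQ : N.Connects Q) :
    Code.{u} N 4 n where
  Key _ := PUnit
  keyLaw _ := Measure.dirac PUnit.unit
  enc e src inc _ :=
    if e ∈ P then forward N P (fun x => (splitBlock n x).1) e src inc
    else if e ∈ Q then forward N Q (fun x => (splitBlock n x).2) e src inc
    else ⟨0, by positivity⟩
  enc_measurable _ _ _ := measurable_const
  dec rec := (splitBlock n).symm
    (rec ⟨hP.1.choose, hP.1.choose_spec.2⟩, rec ⟨hQ.1.choose, hQ.1.choose_spec.2⟩)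

/-- Each link of `P` not leaving the source repeats a predecessor in `P`, which has smaller rank.
Only the encoders on `P` matter, so both routes are covered. -/
theorem signal_eq_of_forward {n : ℕ} (C : Code.{u} N 4 n) {P : Finset E} (hP : N.Connects P)
    (f : (Fin n → Fin 4) → Fin (2 ^ n))
    (hC : ∀ e ∈ P, ∀ src inc k, C.enc e src inc k = forward N P f e src inc) (ω : C.Outcome)
    {e : E} (he : e ∈ P) : C.signal e ω = f ω.1 := by
  induction h : N.rank (N.tail e) using Nat.strong_induction_on generalizing e with
  | _ r ih =>
    rw [Code.signal, hC e he, forward]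
    split_ifs with hs hd
    · rfl
    · have hr := N.rank_lt hd.choose
      rw [hd.choose_spec.2, h] at hr
      exact ih _ hr hd.choose_spec.1 rfl
    · exact absurd (hP.2 e he) (not_or.2 ⟨hs, hd⟩)

/-- The source with uniformly distributed blocks over a four-letter alphabet. -/
noncomputable def uniformSource : Source where
  q := 4
  law n := PMF.uniformOfFintype (Fin n → Fin 4)

theorem uniformSource_hasRate : uniformSource.HasRate 2 := by
  intro δ hδ
  filter_upwards [eventually_gt_atTop 0] with n hn
  have hn' : (n : ℝ) ≠ 0 := by exact_mod_cast hn.ne'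
  have hl : Real.log 2 ≠ 0 := (Real.log_pos (by norm_num)).ne'
  have h4 : Real.log 4 = 2 * Real.log 2 := by
    rw [show (4 : ℝ) = 2 ^ 2 by norm_num, Real.log_pow]; norm_num
  have : entropyBits (uniformSource.law n) = 2 * n := by
    change entropyBits (PMF.uniformOfFintype (Fin n → Fin 4)) = _
    rw [entropyBits, div_eq_iff hl]
    simp [Real.negMulLog, h4]
    ring
  rw [this, mul_div_cancel_right₀ _ hn']
  linarith

/-- Two link-disjoint routes that avoid the wiretapped links carry two bits per time unit secretly. -/
theorem Network.Connects.communicatesSecretly [Fintype V] {P Q A : Finset E} (hP : N.Connects P)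
    (hQ : N.Connects Q) (hPQ : Disjoint P Q) (hPA : Disjoint P A) (hQA : Disjoint Q A) :
    Network.CommunicatesSecretly.{u} N {A} uniformSource := by
  have hsP : ∀ n (ω : (routingCode.{u} n hP hQ).Outcome), ∀ e ∈ P,
      (routingCode n hP hQ).signal e ω = (splitBlock n ω.1).1 := fun n ω e he =>
    signal_eq_of_forward _ hP _ (fun e he src inc k => if_pos he) ω he
  have hsQ : ∀ n (ω : (routingCode.{u} n hP hQ).Outcome), ∀ e ∈ Q,
      (routingCode n hP hQ).signal e ω = (splitBlock n ω.1).2 := fun n ω e he =>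
    signal_eq_of_forward _ hQ _ (fun e he src inc k =>
      (if_neg (Finset.disjoint_right.1 hPQ he)).trans (if_pos he)) ω he
  refine ⟨fun n => routingCode n hP hQ, fun n B hB => ?_, ?_⟩
  · obtain rfl : B = A := hB
    -- Links off both routes always carry the symbol 0.
    have : (routingCode.{u} n hP hQ).observed B = fun _ _ => ⟨0, by positivity⟩ := by
      funext ω e
      rw [Code.observed, Code.signal]
      exact (if_neg (Finset.disjoint_right.1 hPA e.2)).trans
        (if_neg (Finset.disjoint_right.1 hQA e.2))
    change mutualInfo ((routingCode.{u} n hP hQ).outcomeLaw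
      (PMF.uniformOfFintype (Fin n → Fin 4))) (fun ω => ω.1) ((routingCode n hP hQ).observed B) = 0
    rw [this]
    exact mutualInfo_const measurable_fst _
  · refine tendsto_const_nhds.congr fun n => ?_
    have : {ω | (routingCode.{u} n hP hQ).decoded ω ≠ ω.1} = ∅ := by
      ext ω
      simp only [Set.mem_ofPred_eq, Set.mem_empty_iff_false, iff_false, not_not]
      refine (congrArg (splitBlock n).symm (Prod.ext ?_ ?_)).trans
        ((splitBlock n).symm_apply_apply ω.1)
      · exact hsP n ω _ hP.1.choose_spec.1
      · exact hsQ n ω _ hQ.1.choose_spec.1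
    change 0 = (routingCode.{u} n hP hQ).outcomeLaw (PMF.uniformOfFintype (Fin n → Fin 4))
      {ω | (routingCode.{u} n hP hQ).decoded ω ≠ ω.1}
    rw [this, measure_empty]

end routing

/-! ### Disjoint paths in the five-link network, and the cut-set bound -/

/-- Paths from the source to the sink. -/
def paths : List (Finset Link) :=
  [{.z3, .c_t1, .l1, .h1_g, .l8}, {.z3, .c_t1, .l1, .h1_e, .l6}, {.z1, .a_t1, .l1, .h1_e, .l6},
    {.z1, .l2, .h2_e, .l6}, {.z1, .l2, .h2_f, .l7}, {.z1, .a_t3, .l3, .l6},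
    {.z2, .b_t3, .l3, .l6}, {.z2, .l4, .h4_f, .l7}, {.z3, .l5, .l8}]

instance (P : Finset Link) : Decidable (fiveLinkNetwork.Connects P) :=
  inferInstanceAs (Decidable ((∃ e ∈ P, e.ends.2 = Node.d) ∧
    ∀ e ∈ P, e.ends.1 = Node.s ∨ ∃ d ∈ P, d.ends.2 = e.ends.1))

theorem connects_of_mem_paths {P : Finset Link} (hP : P ∈ paths) : fiveLinkNetwork.Connects P := by
  have h : (paths.all fun P => decide (fiveLinkNetwork.Connects P)) = true := by decide +kernel
  exact of_decide_eq_true (List.all_eq_true.1 h P hP)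

/-- Two link-disjoint paths avoid any given wiretap set. -/
theorem exists_disjoint_paths {A : Finset Link} (hA : A ∈ wiretapSets) :
    ∃ P Q, fiveLinkNetwork.Connects P ∧ fiveLinkNetwork.Connects Q ∧ Disjoint P Q ∧
      Disjoint P A ∧ Disjoint Q A := by
  have h : (middleLayer.powersetCard 3).filter (fun A => (paths.any fun P => paths.any fun Q =>
      decide (Disjoint P Q ∧ Disjoint P A ∧ Disjoint Q A)) = false) = ∅ := by decide +kernel
  have hA' := Finset.filter_eq_empty_iff.1 h (Finset.mem_powersetCard.2 hA)
  obtain ⟨P, hP, h⟩ := List.any_eq_true.1 ((Bool.not_eq_false _).mp hA')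
  obtain ⟨Q, hQ, hd⟩ := List.any_eq_true.1 h
  exact ⟨P, Q, connects_of_mem_paths hP, connects_of_mem_paths hQ, of_decide_eq_true hd⟩

theorem cutSetBound_eq_two : fiveLinkNetwork.cutSetBound wiretapSets = 2 := by
  refine le_antisymm ?_ (le_iInf₂ fun S hS => le_iInf₂ fun A hA => ?_)
  -- This cut is crossed exactly by the middle layer; tapping links 1, 2, 3 leaves links 4 and 5.
  · let S : Finset Node := {.s, .a, .b, .c, .t1, .t3}
    have hS : fiveLinkNetwork.source ∈ (S : Set Node) ∧ fiveLinkNetwork.sink ∉ (S : Set Node) :=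
      ⟨Finset.mem_coe.2 (by decide), mt Finset.mem_coe.1 (by decide)⟩
    refine (iInf₂_le (S : Set Node) hS).trans
      ((iInf₂_le ({.l1, .l2, .l3} : Finset Link) ⟨by decide, by decide⟩).trans ?_)
    rw [← Set.encard_pair (by decide : Link.l4 ≠ Link.l5)]
    refine Set.encard_le_encard fun e he => ?_
    have key : ∀ e : Link, e.ends.1 ∈ S → e.ends.2 ∉ S →
        e ∉ ({.l1, .l2, .l3} : Finset Link) → e = .l4 ∨ e = .l5 := by decide
    exact key e (Finset.mem_coe.1 he.1) (mt Finset.mem_coe.2 he.2.1) he.2.2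
  · obtain ⟨P, Q, hP, hQ, hPQ, hPA, hQA⟩ := exists_disjoint_paths hA
    exact hP.two_le_encard hQ hPQ hPA hQA hS.1 hS.2

theorem achievableKnown_two : Network.AchievableKnown.{u} fiveLinkNetwork wiretapSets 2 := by
  refine ⟨uniformSource, uniformSource_hasRate, fun A hA => ?_⟩
  obtain ⟨P, Q, hP, hQ, hPQ, hPA, hQA⟩ := exists_disjoint_paths hA
  exact hP.communicatesSecretly hQ hPQ hPA hQA

end SecureNet

theorem theorem2 :
    SecureNet.fiveLinkNetwork.cutSetBound SecureNet.wiretapSets = 2 ∧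
    SecureNet.Network.AchievableKnown.{u} SecureNet.fiveLinkNetwork SecureNet.wiretapSets 2 ∧
    ¬ SecureNet.Network.Achievable.{u} SecureNet.fiveLinkNetwork SecureNet.wiretapSets 2 :=
  ⟨SecureNet.cutSetBound_eq_two, SecureNet.achievableKnown_two, SecureNet.not_achievable_two⟩
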